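/- Let $G$ be a finite graph with vertex set $V$ and edge set $E$. A surjective labeling $f:E\to\{0,1\}$ is edge-friendly if the numbers of edges labeled $0$ and $1$ differ by at most one. For $i\in\{0,1\}$ let $v_f(i)$ be the number of vertices incident to strictly more edges labeled $i$ than edges labeled $1-i$. The edge-balanced index set of $G$ is $EBI(G)=\{|v_f(0)-v_f(1)| : f \text{ is an edge-friendly labeling of } G\}$. Theorem. For every odd integer $n>5$ and every integer $a$ with $1<a\le \frac{n-3}{4}$, the complete bipartite graph $K_{n,n-2a}$ satisfies $$EBI(K_{n,n-2a})=\{0,2,\dots,2n-2a-8,2n-2a-6\},$$ that is, $EBI(K_{n,n-2a})$ is the set of all even integers $k$ with $0\le k\le 2n-2a-6$. -/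

import Mathlib

noncomputable section

namespace EdgeBalance

variable {V : Type*} {G : SimpleGraph V}

/-- `e_f(i)`: the number of edges labeled `i`. -/
def edgeCount (f : G.edgeSet → ZMod 2) (i : ZMod 2) : ℕ :=
  {e : G.edgeSet | f e = i}.ncard

/-- The number of edges incident to `v` that are labeled `i`. -/
def labelDegree (f : G.edgeSet → ZMod 2) (i : ZMod 2) (v : V) : ℕ :=
  {e : G.edgeSet | v ∈ (e : Sym2 V) ∧ f e = i}.ncard

/-- An edge labeling is a surjective labeling of the edges; it is edge-friendly if
`|e_f(0) - e_f(1)| ≤ 1`. -/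
def IsEdgeFriendly (f : G.edgeSet → ZMod 2) : Prop :=
  Function.Surjective f ∧ |(edgeCount f 0 : ℤ) - (edgeCount f 1 : ℤ)| ≤ 1

/-- The induced partial vertex labeling `f⁺`; the value `none` means that the vertex is
unlabeled. -/
def inducedLabel (f : G.edgeSet → ZMod 2) (v : V) : Option (ZMod 2) :=
  if labelDegree f 1 v < labelDegree f 0 v then some 0
  else if labelDegree f 0 v < labelDegree f 1 v then some 1
  else none

/-- `v_f(i)`: the number of vertices whose induced label is `i`. -/
def vertexCount (f : G.edgeSet → ZMod 2) (i : ZMod 2) : ℕ :=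
  {v : V | inducedLabel f v = some i}.ncard

/-- The edge-balanced index set `EBI(G)` of a finite graph `G`. -/
def EBI {V : Type*} [Finite V] (G : SimpleGraph V) : Set ℕ :=
  {k : ℕ | ∃ f : G.edgeSet → ZMod 2, IsEdgeFriendly f ∧
    (k : ℤ) = |(vertexCount f 0 : ℤ) - (vertexCount f 1 : ℤ)|}

end EdgeBalance

end

/-! # The edge-balanced index set of `K_{n, n-2a}`

A labeling of the edges of `K_{n,m}` is an `n × m` matrix over `ZMod 2`, and the label of a vertex
is the strict majority in its row or column. Here `n` and `m = n - 2a` are odd, so every vertex is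
labeled, `|v_f(0) - v_f(1)|` has the parity of `n + m`, and each of the two labels is carried by at
least `(nm - 1) / 2` edges.

*Upper bound.* Fix a label `c`. A row in which `c` is not the majority contains `c` at most
`(m - 1) / 2` times, so with at most one exceptional row there would be at most
`m + (n - 1)(m - 1) / 2` entries `c`, which is less than `(nm - 1) / 2` because `a > 1`. Likewise at
least one column has majority `c`. So each label occurs on at least three vertices
(`three_le_vertexCount`).

*Construction.* Write `n = 2ν + 1` and `m = 2μ + 1`. One column is filled with ones, and every
other column gets at most `ν` ones; then exactly one column has label `1`. If row `i` has `r i` ones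
outside the full column, its label is `1` exactly when `μ ≤ r i`, so one can prescribe the number
`p` of rows with label `1`. The row sums `r i` can be chosen with the required total
(`exists_sum_range_eq`), and laying the ones of successive rows out cyclically keeps the column sums
balanced (`exists_balanced_rows`). This works for all `2 ≤ p ≤ n - a - 1`, which gives every even
value in the range.
-/

noncomputable section

namespace EdgeBalance

open Finset

/-! ### Sequences and matrices with prescribed sums -/

/-- Discrete intermediate values: sums of integer sequences between `l` and `u` fill the whole
interval between `∑ l` and `∑ u`. -/
theorem exists_sum_range_eq (l u : ℕ → ℕ) (hlu : ∀ i, l i ≤ u i) (n R : ℕ)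
    (hl : ∑ i ∈ range n, l i ≤ R) (hu : R ≤ ∑ i ∈ range n, u i) :
    ∃ r : ℕ → ℕ, (∀ i, l i ≤ r i ∧ r i ≤ u i) ∧ ∑ i ∈ range n, r i = R := by
  induction n generalizing R with
  | zero => exact ⟨l, fun i => ⟨le_rfl, hlu i⟩, by simp at hu ⊢; omega⟩
  | succ k ih =>
    rw [sum_range_succ] at hl hu
    have hk := hlu k
    have hsum : ∑ i ∈ range k, l i ≤ ∑ i ∈ range k, u i := sum_le_sum fun i _ => hlu i
    -- The last term takes as much as it can.
    obtain ⟨x, hx1, hx2, hx3, hx4, hx5⟩ : ∃ x, l k ≤ x ∧ x ≤ u k ∧ x ≤ R ∧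
        ∑ i ∈ range k, l i ≤ R - x ∧ R - x ≤ ∑ i ∈ range k, u i :=
      ⟨min (u k) (R - ∑ i ∈ range k, l i), by omega, by omega, by omega, by omega, by omega⟩
    obtain ⟨r, hr, hs⟩ := ih (R - x) hx4 hx5
    refine ⟨Function.update r k x, fun i => ?_, ?_⟩
    · by_cases h : i = k
      · subst h; simp [hx1, hx2]
      · simpa [h] using hr i
    · rw [sum_range_succ, Function.update_self,
        sum_congr rfl fun i hi => Function.update_of_ne (by simp at hi; omega) x r, hs]
      omega

theorem sum_range_ite_lt (p n x y : ℕ) (hp : p ≤ n) :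
    ∑ i ∈ range n, (if i < p then x else y) = p * x + (n - p) * y := by
  obtain ⟨d, rfl⟩ := Nat.exists_eq_add_of_le hp
  rw [sum_range_add, sum_congr rfl fun i hi => if_pos (by simpa using hi)]
  simp

/-- Prescribed row sums `r i ≤ M` with total at most `M * ν` are realized by subsets `A i` of the
`M` columns such that no column is used more than `ν` times: the `i`-th row takes the next `r i`
columns in cyclic order. -/
theorem exists_balanced_rows (n M ν : ℕ) (r : ℕ → ℕ) (hr : ∀ i, r i ≤ M)
    (hR : ∑ i ∈ range n, r i ≤ M * ν) :
    ∃ A : ℕ → Finset ℕ, (∀ i, A i ⊆ range M) ∧ (∀ i, #(A i) = r i) ∧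
      ∀ c, #{i ∈ range n | c ∈ A i} ≤ ν := by
  set S : ℕ → ℕ := fun k => ∑ i ∈ range k, r i with hS
  have hSs : ∀ i, S (i + 1) = S i + r i := fun i => sum_range_succ _ _
  have hmono : Monotone S := monotone_nat_of_le_succ fun i => by rw [hSs]; omega
  refine ⟨fun i => (Ico (S i) (S (i + 1))).image (· % M), fun i => ?_, fun i => ?_, fun c => ?_⟩
  · intro c hc
    obtain ⟨t, ht, rfl⟩ := mem_image.1 hc
    have := hr i
    have := hSs i
    rw [mem_Ico] at ht
    exact mem_range.2 (Nat.mod_lt _ (by omega))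
  · rw [card_image_of_injOn, Nat.card_Ico, hSs]
    · omega
    · intro s hs t ht hst
      simp only [coe_Ico, Set.mem_Ico] at hs ht
      have := hr i
      have := hSs i
      exact Nat.ModEq.eq_of_abs_lt hst (by rw [abs_lt]; omega)
  · -- The positions congruent to `c` are distinguished by their quotients by `M`.
    have key : ∀ i, c ∈ (Ico (S i) (S (i + 1))).image (· % M) →
        ∃ t, S i ≤ t ∧ t < S (i + 1) ∧ t % M = c := by
      intro i hi
      obtain ⟨t, ht, rfl⟩ := mem_image.1 hi
      rw [mem_Ico] at ht
      exact ⟨t, ht.1, ht.2, rfl⟩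
    choose! t ht1 ht2 ht3 using key
    rw [← card_range ν]
    refine card_le_card_of_injOn (fun i => t i / M) ?_ ?_
    · intro i hi
      rw [mem_coe, mem_filter, mem_range] at hi
      rw [mem_coe, mem_range]
      refine Nat.div_lt_of_lt_mul ?_
      have := ht2 i hi.2
      have : S (i + 1) ≤ S n := hmono hi.1
      have : S n ≤ M * ν := hR
      omega
    · intro i hi j hj hij
      rw [mem_coe, mem_filter] at hi hj
      have htt : t i = t j := by
        rw [← Nat.div_add_mod (t i) M, ← Nat.div_add_mod (t j) M, ht3 i hi.2, ht3 j hj.2]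
        simp only at hij
        rw [hij]
      have hi1 := ht1 i hi.2
      have hi2 := ht2 i hi.2
      have hj1 := ht1 j hj.2
      have hj2 := ht2 j hj.2
      by_contra hne
      rcases Nat.lt_or_gt_of_ne hne with h | h
      · have : S (i + 1) ≤ S j := hmono h
        omega
      · have : S (j + 1) ≤ S i := hmono h
        omega

/-! ### Edge labelings of complete bipartite graphs as matrices -/

section Bipartite

variable {α β : Type*}

/-- The edges of the complete bipartite graph on `α ⊕ β` correspond to the pairs in `α × β`. -/
def edgeEquiv (α β : Type*) : α × β ≃ (completeBipartiteGraph α β).edgeSet :=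
  Equiv.ofBijective (fun p => ⟨s(Sum.inl p.1, Sum.inr p.2), by simp⟩) (by
    constructor
    · rintro ⟨i, j⟩ ⟨i', j'⟩ h
      simpa using h
    · rintro ⟨e, he⟩
      induction e using Sym2.ind with
      | _ x y =>
        rcases x with i | i <;> rcases y with j | j <;> simp at he
        · exact ⟨(i, j), rfl⟩
        · exact ⟨(j, i), Subtype.ext Sym2.eq_swap⟩)

@[simp]
theorem coe_edgeEquiv (p : α × β) :
    (edgeEquiv α β p : Sym2 (α ⊕ β)) = s(Sum.inl p.1, Sum.inr p.2) := rfl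

/-- The matrix of an edge labeling of a complete bipartite graph. -/
def entry (f : (completeBipartiteGraph α β).edgeSet → ZMod 2) (i : α) (j : β) : ZMod 2 :=
  f (edgeEquiv α β (i, j))

variable (f : (completeBipartiteGraph α β).edgeSet → ZMod 2)

theorem labelDegree_inl [Fintype β] (c : ZMod 2) (i : α) :
    labelDegree f c (Sum.inl i) = #{j | entry f i j = c} := by
  rw [labelDegree, ← Set.ncard_coe_finset]
  symm
  refine Set.ncard_congr (fun j _ => edgeEquiv α β (i, j)) ?_ ?_ ?_
  · intro j hj
    exact ⟨by simp, (mem_filter.1 (mem_coe.1 hj)).2⟩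
  · intro j j' _ _ h
    simpa using h
  · intro e he
    obtain ⟨⟨i', j⟩, rfl⟩ := (edgeEquiv α β).surjective e
    have : i = i' := by simpa using he.1
    subst this
    exact ⟨j, mem_coe.2 (mem_filter.2 ⟨mem_univ _, he.2⟩), rfl⟩

theorem labelDegree_inr [Fintype α] (c : ZMod 2) (j : β) :
    labelDegree f c (Sum.inr j) = #{i | entry f i j = c} := by
  rw [labelDegree, ← Set.ncard_coe_finset]
  symm
  refine Set.ncard_congr (fun i _ => edgeEquiv α β (i, j)) ?_ ?_ ?_
  · intro i hi
    exact ⟨by simp, (mem_filter.1 (mem_coe.1 hi)).2⟩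
  · intro i i' _ _ h
    simpa using h
  · intro e he
    obtain ⟨⟨i, j'⟩, rfl⟩ := (edgeEquiv α β).surjective e
    have : j = j' := by simpa using he.1
    subst this
    exact ⟨i, mem_coe.2 (mem_filter.2 ⟨mem_univ _, he.2⟩), rfl⟩

theorem card_fiber_add_card_fiber {ι : Type*} [Fintype ι] (g : ι → ZMod 2) (c : ZMod 2) :
    #{i | g i = c} + #{i | g i = c + 1} = Fintype.card ι := by
  have h : ∀ x : ZMod 2, x = c + 1 ↔ ¬ x = c := by revert c; decide
  simp only [h]
  rw [card_filter_add_card_filter_not, card_univ]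

theorem labelDegree_inl_add [Fintype β] (c : ZMod 2) (i : α) :
    labelDegree f c (Sum.inl i) + labelDegree f (c + 1) (Sum.inl i) = Fintype.card β := by
  rw [labelDegree_inl, labelDegree_inl, card_fiber_add_card_fiber]

theorem labelDegree_inr_add [Fintype α] (c : ZMod 2) (j : β) :
    labelDegree f c (Sum.inr j) + labelDegree f (c + 1) (Sum.inr j) = Fintype.card α := by
  rw [labelDegree_inr, labelDegree_inr, card_fiber_add_card_fiber]

variable [Fintype α] [Fintype β]

theorem edgeCount_eq_card (c : ZMod 2) :
    edgeCount f c = #{p : α × β | entry f p.1 p.2 = c} := by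
  rw [edgeCount, ← Set.ncard_coe_finset]
  symm
  refine Set.ncard_congr (fun p _ => edgeEquiv α β p) ?_ ?_ ?_
  · intro p hp
    simpa [entry] using hp
  · intro p q _ _ h
    simpa using h
  · intro e he
    obtain ⟨p, rfl⟩ := (edgeEquiv α β).surjective e
    exact ⟨p, by simpa [entry] using he, rfl⟩

theorem edgeCount_eq_sum_inl (c : ZMod 2) :
    edgeCount f c = ∑ i : α, labelDegree f c (Sum.inl i) := by
  simp only [edgeCount_eq_card, labelDegree_inl, card_filter, Fintype.sum_prod_type]

theorem edgeCount_eq_sum_inr (c : ZMod 2) :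
    edgeCount f c = ∑ j : β, labelDegree f c (Sum.inr j) := by
  simp only [edgeCount_eq_card, labelDegree_inr, card_filter, Fintype.sum_prod_type_right]

theorem edgeCount_add (c : ZMod 2) :
    edgeCount f c + edgeCount f (c + 1) = Fintype.card α * Fintype.card β := by
  rw [edgeCount_eq_card, edgeCount_eq_card,
    card_fiber_add_card_fiber (fun p : α × β => entry f p.1 p.2), Fintype.card_prod]

theorem inducedLabel_eq_some_iff {V : Type*} {G : SimpleGraph V} (f : G.edgeSet → ZMod 2)
    (c : ZMod 2) (v : V) :
    inducedLabel f v = some c ↔ labelDegree f (c + 1) v < labelDegree f c v := by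
  unfold inducedLabel
  obtain rfl | rfl : c = 0 ∨ c = 1 := by revert c; decide
  · rw [zero_add]
    split_ifs <;> simp <;> omega
  · rw [show (1 + 1 : ZMod 2) = 0 from rfl]
    split_ifs <;> simp <;> omega

theorem vertexCount_eq (c : ZMod 2) :
    vertexCount f c = #{i : α | labelDegree f (c + 1) (Sum.inl i) < labelDegree f c (Sum.inl i)} +
      #{j : β | labelDegree f (c + 1) (Sum.inr j) < labelDegree f c (Sum.inr j)} := by
  classical
  simp only [vertexCount, inducedLabel_eq_some_iff]
  rw [Set.ncard_eq_toFinset_card', Set.toFinset_ofPred, card_filter, Fintype.sum_sum_type,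
    card_filter, card_filter]

/-- If both parts have odd size, then so does every degree, and all vertices are labeled. -/
theorem vertexCount_add (hα : Odd (Fintype.card α)) (hβ : Odd (Fintype.card β)) :
    vertexCount f 0 + vertexCount f 1 = Fintype.card α + Fintype.card β := by
  obtain ⟨u, hu⟩ := hα
  obtain ⟨v, hv⟩ := hβ
  have h1 : ∀ i, labelDegree f 0 (Sum.inl i) < labelDegree f 1 (Sum.inl i) ↔
      ¬ labelDegree f 1 (Sum.inl i) < labelDegree f 0 (Sum.inl i) := fun i => by
    have := labelDegree_inl_add f 0 i
    rw [zero_add] at this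
    omega
  have h2 : ∀ j, labelDegree f 0 (Sum.inr j) < labelDegree f 1 (Sum.inr j) ↔
      ¬ labelDegree f 1 (Sum.inr j) < labelDegree f 0 (Sum.inr j) := fun j => by
    have := labelDegree_inr_add f 0 j
    rw [zero_add] at this
    omega
  rw [vertexCount_eq, vertexCount_eq, zero_add, show (1 + 1 : ZMod 2) = 0 from rfl]
  simp only [h1, h2]
  rw [add_add_add_comm, card_filter_add_card_filter_not, card_filter_add_card_filter_not,
    card_univ, card_univ]

/-! ### Each label occurs on at least three vertices -/

/-- If only the indices satisfying `P` may have `d i > k`, and none exceeds `2k + 1`, then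
`∑ d ≤ |ι| k + |P| (k + 1)`. -/
theorem sum_le_of_le_half {ι : Type*} [Fintype ι] (d : ι → ℕ) (k : ℕ) (P : ι → Prop)
    [DecidablePred P] (h : ∀ i, d i ≤ 2 * k + 1) (hP : ∀ i, ¬ P i → d i ≤ k) :
    ∑ i, d i ≤ Fintype.card ι * k + #{i | P i} * (k + 1) := by
  calc ∑ i, d i ≤ ∑ i, (k + if P i then k + 1 else 0) := by
        refine sum_le_sum fun i _ => ?_
        have := h i
        have := hP i
        split_ifs with hp
        · omega
        · simpa using hP i hp
    _ = _ := by
        rw [sum_add_distrib, ← sum_filter]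
        simp

theorem three_le_vertexCount (μ a : ℕ) (ha : 1 < a) (hα : Fintype.card α = 2 * (μ + a) + 1)
    (hβ : Fintype.card β = 2 * μ + 1) (hμ : 1 ≤ μ) (c : ZMod 2)
    (hf : edgeCount f (c + 1) ≤ edgeCount f c + 1) : 3 ≤ vertexCount f c := by
  have hE := edgeCount_add f c
  have h1 := sum_le_of_le_half (fun i : α => labelDegree f c (Sum.inl i)) μ
    (fun i => labelDegree f (c + 1) (Sum.inl i) < labelDegree f c (Sum.inl i))
    (fun i => by have := labelDegree_inl_add f c i; omega)
    (fun i hi => by have := labelDegree_inl_add f c i; omega)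
  have h2 := sum_le_of_le_half (fun j : β => labelDegree f c (Sum.inr j)) (μ + a)
    (fun j => labelDegree f (c + 1) (Sum.inr j) < labelDegree f c (Sum.inr j))
    (fun j => by have := labelDegree_inr_add f c j; omega)
    (fun j hj => by have := labelDegree_inr_add f c j; omega)
  rw [vertexCount_eq]
  rw [← edgeCount_eq_sum_inl] at h1
  rw [← edgeCount_eq_sum_inr] at h2
  generalize #{i : α | labelDegree f (c + 1) (Sum.inl i) < labelDegree f c (Sum.inl i)} = P at *
  generalize #{j : β | labelDegree f (c + 1) (Sum.inr j) < labelDegree f c (Sum.inr j)} = Q at *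
  rw [hα] at h1 hE
  rw [hβ] at h2 hE
  have hP : 2 ≤ P := by
    by_contra hlt
    have : P * (μ + 1) ≤ 1 * (μ + 1) := Nat.mul_le_mul_right _ (by omega)
    nlinarith
  have hQ : 1 ≤ Q := by
    by_contra hlt
    obtain rfl : Q = 0 := by omega
    nlinarith
  omega

end Bipartite

/-! ### Labelings with one column and prescribed many rows labeled `1` -/

theorem exists_edgeFriendly (n m μ a p : ℕ) (hn : n = 2 * (μ + a) + 1) (hm : m = 2 * μ + 1)
    (ha : 1 < a) (hμ : a < μ) (hp : 2 ≤ p) (hpn : p + a + 1 ≤ n) :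
    ∃ f : (completeBipartiteGraph (Fin n) (Fin m)).edgeSet → ZMod 2,
      IsEdgeFriendly f ∧ vertexCount f 1 = p + 1 := by
  -- `R` is the number of ones outside the full column, for a total of `(n * m - 1) / 2`.
  obtain ⟨R, hR⟩ : ∃ R, R + (a + 1) = 2 * μ * (μ + a) :=
    ⟨2 * μ * (μ + a) - (a + 1), Nat.sub_add_cancel (by nlinarith)⟩
  obtain ⟨d, hd⟩ := Nat.exists_eq_add_of_le (show p ≤ n by omega)
  obtain ⟨k, rfl⟩ : ∃ k, μ = k + 1 := ⟨μ - 1, by omega⟩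
  obtain ⟨r, hr, hrs⟩ := exists_sum_range_eq (fun i => if i < p then k + 1 else 0)
    (fun i => if i < p then 2 * (k + 1) else k) (fun i => by split_ifs <;> omega) n R
    (by
      rw [sum_range_ite_lt _ _ _ _ (by omega)]
      have : p * (k + 1) ≤ (2 * (k + 1) + a) * (k + 1) := Nat.mul_le_mul_right _ (by omega)
      nlinarith)
    (by
      rw [sum_range_ite_lt _ _ _ _ (by omega), show n - p = d by omega]
      have hd' : d = 2 * (k + 1 + a) + 1 - p := by omega
      have h2 : 2 * (k + 2) ≤ p * (k + 2) := Nat.mul_le_mul_right _ hp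
      have h3 : (p + d) * k = (2 * (k + 1 + a) + 1) * k := by rw [← hd, hn]
      nlinarith)
  obtain ⟨A, hA, hAr, hAc⟩ := exists_balanced_rows n (2 * (k + 1)) (k + 1 + a) r
    (fun i => by have := (hr i).2; split_ifs at this <;> omega) (by rw [hrs]; omega)
  let x : Fin n → Fin m → ZMod 2 := fun i j => if j.val = 2 * (k + 1) ∨ j.val ∈ A i then 1 else 0
  let f : (completeBipartiteGraph (Fin n) (Fin m)).edgeSet → ZMod 2 :=
    fun e => x ((edgeEquiv _ _).symm e).1 ((edgeEquiv _ _).symm e).2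
  have hx : ∀ i j, entry f i j = 1 ↔ j.val = 2 * (k + 1) ∨ j.val ∈ A i := by
    intro i j
    simp only [entry, f, x, Equiv.symm_apply_apply]
    split_ifs with h <;> simp [h]
  have hrow : ∀ i : Fin n, labelDegree f 1 (Sum.inl i) = r i + 1 := by
    intro i
    have hmem : 2 * (k + 1) ∉ A i := fun h => by simpa using hA i h
    rw [labelDegree_inl, ← hAr, ← card_insert_of_notMem hmem, ← card_map Fin.valEmbedding]
    congr 1
    ext c
    simp only [hx, mem_map, mem_filter, mem_univ, true_and, Fin.valEmbedding_apply, mem_insert]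
    constructor
    · rintro ⟨j, hj, rfl⟩
      exact hj
    · intro hc
      have : c < m := by
        rcases hc with rfl | hc
        · omega
        · have := mem_range.1 (hA i hc)
          omega
      exact ⟨⟨c, this⟩, hc, rfl⟩
  have hcol : ∀ j : Fin m, j.val ≠ 2 * (k + 1) → labelDegree f 1 (Sum.inr j) ≤ k + 1 + a := by
    intro j hj
    refine le_trans ?_ (hAc j)
    rw [labelDegree_inr, ← card_map Fin.valEmbedding]
    refine card_le_card fun c hc => ?_
    simp only [hx, hj, false_or, mem_map, mem_filter, mem_univ, true_and,
      Fin.valEmbedding_apply] at hc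
    obtain ⟨i, hi, rfl⟩ := hc
    simp [hi]
  have hcol' : ∀ j : Fin m, j.val = 2 * (k + 1) → labelDegree f 1 (Sum.inr j) = n := by
    intro j hj
    simp [labelDegree_inr, hx, hj]
  have hE1 : edgeCount f 1 = R + n := by
    rw [edgeCount_eq_sum_inl]
    simp only [hrow]
    rw [Fin.sum_univ_eq_sum_range (fun i => r i + 1), sum_add_distrib, hrs]
    simp
  have hE : edgeCount f 0 + edgeCount f 1 = n * m := by simpa using edgeCount_add f 0
  have hE0 : edgeCount f 0 = R + n + 1 := by
    have : n * m = 2 * (R + n) + 1 := by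
      rw [hm, hn]
      nlinarith
    omega
  refine ⟨f, ⟨?_, by rw [hE0, hE1]; push_cast; simp⟩, ?_⟩
  · -- Both labels occur, since both edge counts are positive.
    have key : ∀ c, edgeCount f c ≠ 0 → ∃ e, f e = c := fun c hc =>
      Set.nonempty_of_ncard_ne_zero hc
    intro c
    obtain rfl | rfl : c = 0 ∨ c = 1 := by revert c; decide
    · exact key 0 (by omega)
    · exact key 1 (by omega)
  · rw [vertexCount_eq, show (1 + 1 : ZMod 2) = 0 from rfl]
    have hrows : ∀ i : Fin n,
        labelDegree f 0 (Sum.inl i) < labelDegree f 1 (Sum.inl i) ↔ i.val < p := by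
      intro i
      have h := labelDegree_inl_add f 0 i
      rw [zero_add, hrow, Fintype.card_fin] at h
      rw [hrow]
      have := hr i
      split_ifs at this <;> omega
    have hcols : ∀ j : Fin m, labelDegree f 0 (Sum.inr j) < labelDegree f 1 (Sum.inr j) ↔
        j = ⟨2 * (k + 1), by omega⟩ := by
      intro j
      have h := labelDegree_inr_add f 0 j
      rw [zero_add, Fintype.card_fin] at h
      rw [Fin.ext_iff]
      by_cases hj : j.val = 2 * (k + 1)
      · have := hcol' j hj
        exact iff_of_true (by omega) hj
      · have := hcol j hj
        exact iff_of_false (by omega) hj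
    simp only [hrows, hcols]
    rw [Fin.card_filter_val_lt, min_eq_right (by omega), filter_eq' univ]
    simp

end EdgeBalance

end

theorem theorem2 (n a : ℕ) (hodd : Odd n) (hn : 5 < n) (ha : 1 < a)
    (han : (a : ℚ) ≤ ((n : ℚ) - 3) / 4) :
    EdgeBalance.EBI (completeBipartiteGraph (Fin n) (Fin (n - 2 * a))) =
      {k : ℕ | Even k ∧ (k : ℤ) ≤ 2 * (n : ℤ) - 2 * (a : ℤ) - 6} := by
  have han' : 4 * a + 3 ≤ n := by
    have : (4 * a + 3 : ℚ) ≤ n := by linarith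
    exact_mod_cast this
  obtain ⟨ν, hν⟩ := hodd
  obtain ⟨μ, rfl⟩ := Nat.exists_eq_add_of_le' (show a ≤ ν by omega)
  obtain ⟨m, hm⟩ : ∃ m, m = n - 2 * a := ⟨_, rfl⟩
  rw [← hm]
  have hm' : m = 2 * μ + 1 := by omega
  have htot : ∀ f : (completeBipartiteGraph (Fin n) (Fin m)).edgeSet → ZMod 2,
      EdgeBalance.vertexCount f 0 + EdgeBalance.vertexCount f 1 = n + m := fun f => by
    have := EdgeBalance.vertexCount_add f (by simp [hν]) (by simp [hm'])
    simpa using this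
  ext k
  constructor
  · rintro ⟨f, ⟨-, hf⟩, hk⟩
    have ht := htot f
    rw [abs_le] at hf
    have h0 := EdgeBalance.three_le_vertexCount f μ a ha (by simp [hν]) (by simp [hm'])
      (by omega) 0 (by rw [zero_add]; omega)
    have h1 := EdgeBalance.three_le_vertexCount f μ a ha (by simp [hν]) (by simp [hm'])
      (by omega) 1 (by rw [show (1 + 1 : ZMod 2) = 0 from rfl]; omega)
    rw [Set.mem_ofPred_eq, Nat.even_iff]
    rcases abs_cases ((EdgeBalance.vertexCount f 0 : ℤ) - EdgeBalance.vertexCount f 1) with h | h <;>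
      omega
  · rintro ⟨⟨l, rfl⟩, hk⟩
    -- `p + 1 = n - a - l` vertices get label `1`.
    obtain ⟨f, hf, hv⟩ := EdgeBalance.exists_edgeFriendly n m μ a (n - a - l - 1) hν hm' ha
      (by omega) (by omega) (by omega)
    have ht := htot f
    refine ⟨f, hf, ?_⟩
    rw [abs_of_nonneg (by omega)]
    omega
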